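/- Let $X$ be a random variable with values in a finite set $\mathcal X$ and pmf $P_X$ with $P_X(x)>0$ for all $x$. Let $k\ge 2$, $\mathcal Z=\{0,1,\dots,k-1\}$, and let $f:\mathcal X\to\mathcal Z$ be onto. For $0\le\rho\le 1$, a $\rho$-QR is a stochastic matrix $W:\mathcal X\to\mathcal Z$ with $W(f(x)|x)\ge\rho$ for all $x\in\mathcal X$. For $\rho$-QRs $W_1,\dots,W_n$ let $Z_1,\dots,Z_n$ be conditionally independent given $X$, with $P(Z_t=i\,|\,X=x)=W_t(i|x)$, and put $$\pi_\rho(W_1,\dots,W_n)=\min_{g:\mathcal Z^n\to\mathcal X}P\big(g(Z_1,\dots,Z_n)\ne X\big),\qquad \pi_n(\rho)=\max_{W_1,\dots,W_n\ \rho\text{-QRs}}\pi_\rho(W_1,\dots,W_n),\qquad n\ge 1,$$ and $\pi(\rho)=\max_{W}\min_{g:\mathcal Z\to\mathcal X}P(g(Z)\ne X)$ for a single $\rho$-QR $W$. For a stochastic matrix $V:\mathcal Z\to\mathcal Z$ with $V(i|i)\ge\rho$ for all $i$, let $\pi_\rho(V^n)$ be the value of $\pi_\rho(W_1,\dots,W_n)$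 for $W_t(i|x)=V(i|f(x))$, $t=1,\dots,n$. Let $V_1(i|j)$ equal $\rho$ if $i=j$; $1-\rho$ if $j$ is even and $i=j+1 \bmod k$, or $j$ is odd and $i=j-1$; and $0$ otherwise. Put $P_X(x_i^*)=\max_{x\in f^{-1}(i)}P_X(x)$ for $i\in\mathcal Z$, $S=\sum_{i\in\mathcal Z}P_X(x_i^*)$ and $\rho_c=\max_{x}P_X(x)/S$. Let $D(\cdot\|\cdot)\in[0,\infty]$ be Kullback-Leibler divergence to base $2$, with $2^{-\infty}=0$ and $\log_2 0=-\infty$, and for $n\ge1$ let $D_n=D\big(\mathrm{Ber}(\tfrac1n\lfloor\tfrac n2\rfloor)\,\big\|\,\mathrm{Ber}(\rho)\big)$. For each $0.5<\rho\le 1$: (i) for all $n\ge1$ such that $(\lfloor n/2\rfloor+1)\,2^{-nD_n}\le 1-\min\{\rho,\rho_c\}$, $$\pi_n(\rho)\le 1-S+\left(\left\lfloor\tfrac n2\right\rfloor+1\right)2^{-nD_n}\,S.$$ (ii) If $P_X(x_i^*)\ge P_X(x_{i+1}^*)$ for $i=0,\dots,k-2$, then for every $n\ge1$ $$\pi_n(\rho)\ge\pi_\rho(V_1^n)\ge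 1-S+\frac1{n+1}\,2^{-nD_n}\sum_{i\in\mathcal Z:\ i\text{ odd}}P_X(x_i^*).$$ (iii) $\lim_n\pi_n(\rho)=\pi(1)=1-S$, the exponents $D_n$ tend to $D(\mathrm{Ber}(0.5)\|\mathrm{Ber}(\rho))>0$, and the convergence is at this exponential rate: $$\lim_n\,-\frac1n\log_2\big(\pi_n(\rho)-\pi(1)\big)=D\big(\mathrm{Ber}(0.5)\,\big\|\,\mathrm{Ber}(\rho)\big).$$ Under the ordering assumption of (ii), also $\lim_n-\frac1n\log_2\big(\pi_\rho(V_1^n)-\pi(1)\big)=D(\mathrm{Ber}(0.5)\|\mathrm{Ber}(\rho))$. -/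

import Mathlib

open scoped ENNReal Topology

noncomputable section

namespace QueryPrivacy

variable {𝒳 𝒪 : Type*} {k n : ℕ}

/-- `K : 𝒳 → 𝒪 → ℝ` is a stochastic matrix, `K x o` being the conditional probability `K(o | x)`. -/
def IsStochastic [Fintype 𝒪] (K : 𝒳 → 𝒪 → ℝ) : Prop :=
  (∀ x o, 0 ≤ K x o) ∧ ∀ x, ∑ o, K x o = 1

/-- A `ρ`-recoverable query response for `f`. -/
def IsQR (f : 𝒳 → Fin k) (ρ : ℝ) (W : 𝒳 → Fin k → ℝ) : Prop :=
  IsStochastic W ∧ ∀ x, ρ ≤ W x (f x)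

open Classical in
/-- `P(g(Z) ≠ X)` when `X` has pmf `P` and `Z` has conditional pmf `K x` given `X = x`. -/
def errorProb [Fintype 𝒳] [Fintype 𝒪] (P : 𝒳 → ℝ) (K : 𝒳 → 𝒪 → ℝ) (g : 𝒪 → 𝒳) : ℝ :=
  ∑ x, ∑ o, if g o ≠ x then P x * K x o else 0

/-- The privacy of `K`: the minimum over all estimators `g : 𝒪 → 𝒳` of the error probability. -/
def privacy [Fintype 𝒳] [Fintype 𝒪] (P : 𝒳 → ℝ) (K : 𝒳 → 𝒪 → ℝ) : ℝ :=
  ⨅ g : 𝒪 → 𝒳, errorProb P K g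

/-- The conditional law of `(Z₁, …, Zₙ)` when the responses are conditionally mutually
independent given `X`, the `t`-th one having conditional pmfs `W t`. -/
def prodChannel (W : Fin n → 𝒳 → Fin k → ℝ) : 𝒳 → (Fin n → Fin k) → ℝ :=
  fun x z => ∏ t, W t x (z t)

/-- The single-response `ρ`-privacy `π(ρ)`. -/
def rhoPrivacy [Fintype 𝒳] (P : 𝒳 → ℝ) (f : 𝒳 → Fin k) (ρ : ℝ) : ℝ :=
  sSup {a | ∃ W : 𝒳 → Fin k → ℝ, IsQR f ρ W ∧ a = privacy P W}

/-- The `ρ`-privacy `πₙ(ρ)` for `n` conditionally independent `ρ`-recoverable responses. -/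
def rhoPrivacyN [Fintype 𝒳] (P : 𝒳 → ℝ) (f : 𝒳 → Fin k) (n : ℕ) (ρ : ℝ) : ℝ :=
  sSup {a | ∃ W : Fin n → 𝒳 → Fin k → ℝ, (∀ t, IsQR f ρ (W t)) ∧ a = privacy P (prodChannel W)}

/-- The set of `ρ`-recoverable responses is compact. -/
theorem isCompact_isQR (f : 𝒳 → Fin k) (ρ : ℝ) :
    IsCompact {W : 𝒳 → Fin k → ℝ | IsQR f ρ W} := by
  have hc : IsCompact (Set.univ.pi fun _ : 𝒳 => stdSimplex ℝ (Fin k)) :=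
    isCompact_univ_pi fun _ => isCompact_stdSimplex ℝ (Fin k)
  have hcl : IsClosed {W : 𝒳 → Fin k → ℝ | ∀ x, ρ ≤ W x (f x)} := by
    simp only [Set.ofPred_forall]
    exact isClosed_iInter fun x => isClosed_le (by fun_prop) (by fun_prop)
  refine (hc.inter_right hcl).of_isClosed_subset ?_ ?_
  · have : {W : 𝒳 → Fin k → ℝ | IsQR f ρ W} =
        (Set.univ.pi fun _ : 𝒳 => stdSimplex ℝ (Fin k)) ∩ {W | ∀ x, ρ ≤ W x (f x)} := by
      ext W
      simp only [IsQR, IsStochastic, stdSimplex, Set.mem_ofPred_eq, Set.mem_inter_iff,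
        Set.mem_univ_pi]
      exact ⟨fun h => ⟨fun x => ⟨h.1.1 x, h.1.2 x⟩, h.2⟩,
        fun h => ⟨⟨fun x => (h.1 x).1, fun x => (h.1 x).2⟩, h.2⟩⟩
    rw [this]
    exact hc.isClosed.inter hcl
  · rintro W ⟨⟨h0, h1⟩, h2⟩
    exact ⟨fun x _ => ⟨h0 x, h1 x⟩, h2⟩

/-- The privacy depends continuously on the channel. -/
theorem continuous_privacy [Fintype 𝒳] [Nonempty 𝒳] [Fintype 𝒪] (P : 𝒳 → ℝ) :
    Continuous (privacy P : (𝒳 → 𝒪 → ℝ) → ℝ) := by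
  classical
  have he : ∀ g : 𝒪 → 𝒳, Continuous fun K : 𝒳 → 𝒪 → ℝ => errorProb P K g := by
    intro g
    unfold errorProb
    refine continuous_finsetSum _ fun x _ => continuous_finsetSum _ fun o _ => ?_
    split_ifs <;> fun_prop
  have : (privacy P : (𝒳 → 𝒪 → ℝ) → ℝ) = fun K =>
      Finset.univ.inf' Finset.univ_nonempty fun g : 𝒪 → 𝒳 => errorProb P K g := by
    funext K
    rw [Finset.inf'_univ_eq_ciInf]
    rfl
  rw [this]
  exact Continuous.finset_inf'_apply _ fun g _ => he g

/-- For `ρ ≤ 1` the supremum defining `πₙ(ρ)` is a maximum. -/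
theorem isGreatest_rhoPrivacyN [Fintype 𝒳] [Nonempty 𝒳] (P : 𝒳 → ℝ) (f : 𝒳 → Fin k) (n : ℕ)
    {ρ : ℝ} (hρ : ρ ≤ 1) :
    IsGreatest {a | ∃ W : Fin n → 𝒳 → Fin k → ℝ, (∀ t, IsQR f ρ (W t)) ∧
      a = privacy P (prodChannel W)} (rhoPrivacyN P f n ρ) := by
  have hc : IsCompact (Set.univ.pi fun _ : Fin n => {W : 𝒳 → Fin k → ℝ | IsQR f ρ W}) :=
    isCompact_univ_pi fun _ => isCompact_isQR f ρ
  have hcont : Continuous fun W : Fin n → 𝒳 → Fin k → ℝ => privacy P (prodChannel W) := by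
    refine (continuous_privacy P).comp ?_
    unfold prodChannel
    fun_prop
  have himg : {a | ∃ W : Fin n → 𝒳 → Fin k → ℝ, (∀ t, IsQR f ρ (W t)) ∧
      a = privacy P (prodChannel W)} =
      (fun W : Fin n → 𝒳 → Fin k → ℝ => privacy P (prodChannel W)) ''
        (Set.univ.pi fun _ : Fin n => {W : 𝒳 → Fin k → ℝ | IsQR f ρ W}) := by
    ext a
    simp only [Set.mem_ofPred_eq, Set.mem_image, Set.mem_univ_pi, eq_comm]
  have hne : (Set.univ.pi fun _ : Fin n => {W : 𝒳 → Fin k → ℝ | IsQR f ρ W}).Nonempty := by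
    refine ⟨fun _ x i => if i = f x then 1 else 0, fun _ _ => ⟨⟨fun x i => ?_, fun x => ?_⟩,
      fun x => ?_⟩⟩
    · dsimp only
      split_ifs <;> norm_num
    · simp
    · simpa using hρ
  unfold rhoPrivacyN
  rw [himg]
  exact (hc.image hcont).isGreatest_sSup (hne.image _)

/-- The matrix `V₁`; `V₁ k ρ j i` is `V₁(i | j)`. -/
def V₁ (k : ℕ) (ρ : ℝ) (j i : Fin k) : ℝ :=
  if i = j then ρ
  else if (Even (j : ℕ) ∧ (i : ℕ) = (j + 1) % k) ∨ (Odd (j : ℕ) ∧ (i : ℕ) + 1 = j) then 1 - ρ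
  else 0

/-- The privacy `π_ρ(Vⁿ)` of `n` conditionally i.i.d. add-noise responses with matrix `V`. -/
def addNoisePrivacy [Fintype 𝒳] (P : 𝒳 → ℝ) (f : 𝒳 → Fin k) (n : ℕ)
    (V : Fin k → Fin k → ℝ) : ℝ :=
  privacy P (prodChannel fun (_ : Fin n) x i => V (f x) i)

/-- `P_X(x_i^*)`, the largest probability of a point of the fibre `f⁻¹(i)`. -/
def pStar (P : 𝒳 → ℝ) (f : 𝒳 → Fin k) (i : Fin k) : ℝ :=
  ⨆ x : {x : 𝒳 // f x = i}, P x

/-- The critical value `ρ_c`. -/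
def rhoC (P : 𝒳 → ℝ) (f : 𝒳 → Fin k) : ℝ :=
  (⨆ x, P x) / ∑ i, pStar P f i

/-- The Bernoulli law with probability `a ∈ [0, 1]` of `true`. -/
def ber (a : ℝ) : MeasureTheory.Measure Bool :=
  ProbabilityTheory.bernoulliMeasure true false (Set.projIcc 0 1 zero_le_one a)

/-- Kullback-Leibler divergence `D(Ber(a) ‖ Ber(b))` in bits (possibly `∞`). -/
def berDiv (a b : ℝ) : ℝ≥0∞ :=
  InformationTheory.klDiv (ber a) (ber b) / ENNReal.ofReal (Real.log 2)

/-- `2 ^ (-d)` for `d ∈ [0, ∞]`, with `2 ^ (-∞) = 0`. -/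
def exp2neg (d : ℝ≥0∞) : ℝ :=
  if d = ⊤ then 0 else (2 : ℝ) ^ (-d.toReal)

/-- The logarithm to base 2 of a nonnegative real number, with `log₂ 0 = -∞`. -/
def log2 (a : ℝ) : EReal :=
  if a ≤ 0 then ⊥ else ((Real.logb 2 a : ℝ) : EReal)

/-- `D(Ber(⌊n/2⌋ / n) ‖ Ber(ρ))`. -/
def expo (n : ℕ) (ρ : ℝ) : ℝ≥0∞ :=
  berDiv (((n / 2 : ℕ) : ℝ) / (n : ℝ)) ρ

/-- `A n ≐ 2 ^ (-n d)`, i.e. `-(1/n) log₂ (A n) → d`. -/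
def HasExpRate (A : ℕ → ℝ) (d : ℝ≥0∞) : Prop :=
  Filter.Tendsto (fun n : ℕ => -(((1 / (n : ℝ) : ℝ) : EReal) * log2 (A n))) Filter.atTop
    (𝓝 (d : EReal))

end QueryPrivacy

end

open scoped ENNReal Topology
noncomputable section
namespace QueryPrivacy
variable {𝒳 𝒪 : Type*} {k n : ℕ}

open MeasureTheory InformationTheory Finset Filter

/-! ### Binomial coefficients -/

/-! Write m = ⌊n/2⌋ and let S be the sum of the fibre maxima. Everything rests on squeezing the
excess of the privacy over 1 - S between two multiples of 2^(-n D_n) that differ by a polynomial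
factor.

Upper side: decode by strict majority and answer with the most likely point of the corresponding
fibre. Given that point, its symbol fails to win only if it occurs at most m times. A Chernoff bound
with the optimal tilt shows that this has probability at most 2^(-n D_n), with no polynomial
prefactor (`sum_prod_le_exp2neg`, `privacy_prodChannel_le`).

Lower side: under `V₁` an odd symbol j and its predecessor are confused with each other. For each
output, any estimator loses at least the smaller joint weight of each such pair (`add_sum_min_le`).
Sequences with m copies of j and n - m of j - 1 have probability at least ρ^m (1-ρ)^(n-m) under both
symbols. There are C(n, m) of them, which is at least 2^(-n D_n)/(n+1) after weighting
(`le_sum_min_prod_V₁`, `exp2neg_expo_le_choose`).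

Continuity of the divergence then turns the squeeze into the exponent (`hasExpRate_of_bounds`). -/

theorem factorial_mul_pow_le_factorial_mul_pow (a b : ℕ) :
    a.factorial * a ^ b ≤ b.factorial * a ^ a := by
  rcases le_total a b with h | h
  · calc a.factorial * a ^ b = a.factorial * a ^ (b - a) * a ^ a := by
          rw [mul_assoc, ← pow_add, Nat.sub_add_cancel h]
      _ ≤ _ := Nat.mul_le_mul_right _ (Nat.factorial_mul_pow_sub_le_factorial h)
  · calc a.factorial * a ^ b = b.factorial * a.descFactorial (a - b) * a ^ b := by
          rw [← Nat.factorial_mul_descFactorial (Nat.sub_le a b), Nat.sub_sub_self h]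
      _ ≤ b.factorial * a ^ (a - b) * a ^ b := by
          gcongr
          exact Nat.descFactorial_le_pow _ _
      _ = _ := by rw [mul_assoc, ← pow_add, Nat.sub_add_cancel h]

/-- The largest term of the binomial expansion of `(m + (n - m)) ^ n` is the `m`-th one. -/
theorem choose_mul_pow_le (n m l : ℕ) (hm : m ≤ n) (hl : l ≤ n) :
    m ^ l * (n - m) ^ (n - l) * n.choose l ≤ m ^ m * (n - m) ^ (n - m) * n.choose m := by
  -- Clearing the factorials leaves two instances of a! a^b ≤ b! a^a, one for m and one for n - m.
  have hpos : 0 < l.factorial * (n - l).factorial * (m.factorial * (n - m).factorial) := by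
    positivity
  refine le_of_mul_le_mul_right ?_ hpos
  have h1 := Nat.choose_mul_factorial_mul_factorial hl
  have h2 := Nat.choose_mul_factorial_mul_factorial hm
  calc m ^ l * (n - m) ^ (n - l) * n.choose l *
        (l.factorial * (n - l).factorial * (m.factorial * (n - m).factorial))
      = (m.factorial * m ^ l) * ((n - m).factorial * (n - m) ^ (n - l)) *
        (n.choose l * l.factorial * (n - l).factorial) := by ring
    _ ≤ (l.factorial * m ^ m) * ((n - l).factorial * (n - m) ^ (n - m)) *
        (n.choose l * l.factorial * (n - l).factorial) := by
        exact Nat.mul_le_mul_right _ (Nat.mul_le_mul (factorial_mul_pow_le_factorial_mul_pow _ _)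
          (factorial_mul_pow_le_factorial_mul_pow _ _))
    _ = (l.factorial * m ^ m) * ((n - l).factorial * (n - m) ^ (n - m)) *
        (n.choose m * m.factorial * (n - m).factorial) := by rw [h1, h2]
    _ = _ := by ring

/-- The binomial expansion of n^n has n + 1 terms, each at most the m-th. This is the source of the
factor 1/(n+1). -/
theorem pow_self_le_choose (n m : ℕ) (hm : m ≤ n) :
    n ^ n ≤ (n + 1) * (m ^ m * (n - m) ^ (n - m) * n.choose m) := by
  have h := add_pow m (n - m) n
  rw [Nat.add_sub_cancel' hm] at h
  rw [h]
  calc _ ≤ ∑ _l ∈ range (n + 1), m ^ m * (n - m) ^ (n - m) * n.choose m := by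
        refine sum_le_sum fun l hl => ?_
        exact choose_mul_pow_le n m l hm (Nat.lt_succ_iff.1 (mem_range.1 hl))
    _ = _ := by simp

/-! ### Divergence of Bernoulli laws -/

/-- The divergence `D(Ber(a) ‖ Ber(b))` in nats, as a real expression. -/
def berKL (a b : ℝ) : ℝ :=
  a * Real.log (a / b) + (1 - a) * Real.log ((1 - a) / (1 - b))

instance (a : ℝ) : IsProbabilityMeasure (ber a) := by
  unfold ber; infer_instance

theorem ber_real_true {a : ℝ} (h0 : 0 ≤ a) (h1 : a ≤ 1) : (ber a).real {true} = a := by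
  unfold ber
  rw [Set.projIcc_of_mem zero_le_one ⟨h0, h1⟩,
    ProbabilityTheory.bernoulliMeasure_real_apply_of_mem_of_notMem _ (by simp) (by simp) (by simp)]

theorem ber_real_false {a : ℝ} (h0 : 0 ≤ a) (h1 : a ≤ 1) : (ber a).real {false} = 1 - a := by
  unfold ber
  rw [Set.projIcc_of_mem zero_le_one ⟨h0, h1⟩,
    ProbabilityTheory.bernoulliMeasure_real_apply_of_notMem_of_mem _ (by simp) (by simp) (by simp)]

theorem ber_absolutelyContinuous (a : ℝ) {b : ℝ} (h0 : 0 < b) (h1 : b < 1) :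
    ber a ≪ ber b := by
  intro s hs
  have key : ∀ c : Bool, c ∉ s := by
    intro c hc
    have h : (ber b).real {c} = 0 := by
      rw [measureReal_def, measure_mono_null (Set.singleton_subset_iff.2 hc) hs]; rfl
    cases c
    · rw [ber_real_false h0.le h1.le] at h; linarith
    · rw [ber_real_true h0.le h1.le] at h; linarith
  rw [Set.eq_empty_of_forall_notMem key, measure_empty]

theorem toReal_rnDeriv_mul_real_singleton {α : Type*} [MeasurableSpace α]
    [MeasurableSingletonClass α] {μ ν : Measure α} [IsFiniteMeasure μ] [IsFiniteMeasure ν]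
    (h : μ ≪ ν) (c : α) : (μ.rnDeriv ν c).toReal * ν.real {c} = μ.real {c} := by
  have := Measure.setLIntegral_rnDeriv h {c}
  rw [lintegral_singleton] at this
  rw [measureReal_def, measureReal_def, ← this, ENNReal.toReal_mul]

theorem toReal_klDiv_ber {a b : ℝ} (ha0 : 0 ≤ a) (ha1 : a ≤ 1) (h0 : 0 < b) (h1 : b < 1) :
    (klDiv (ber a) (ber b)).toReal = berKL a b := by
  have hac := ber_absolutelyContinuous a h0 h1
  have ht := toReal_rnDeriv_mul_real_singleton hac true
  have hf := toReal_rnDeriv_mul_real_singleton hac false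
  rw [ber_real_true ha0 ha1, ber_real_true h0.le h1.le] at ht
  rw [ber_real_false ha0 ha1, ber_real_false h0.le h1.le] at hf
  rw [toReal_klDiv_of_measure_eq hac (by rw [measure_univ, measure_univ]), integral_fintype Integrable.of_finite]
  simp only [Fintype.sum_bool, ber_real_true ha0 ha1, ber_real_false ha0 ha1, llr, smul_eq_mul]
  rw [eq_div_of_mul_eq h0.ne' ht, eq_div_of_mul_eq (by linarith) hf, berKL]

theorem klDiv_ber_ne_top (a : ℝ) {b : ℝ} (h0 : 0 < b) (h1 : b < 1) :
    klDiv (ber a) (ber b) ≠ ⊤ :=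
  klDiv_ne_top (ber_absolutelyContinuous a h0 h1) Integrable.of_finite

theorem berKL_nonneg {a b : ℝ} (ha0 : 0 ≤ a) (ha1 : a ≤ 1) (h0 : 0 < b) (h1 : b < 1) :
    0 ≤ berKL a b := by
  rw [← toReal_klDiv_ber ha0 ha1 h0 h1]; exact ENNReal.toReal_nonneg

theorem berDiv_eq_ofReal {a b : ℝ} (ha0 : 0 ≤ a) (ha1 : a ≤ 1) (h0 : 0 < b) (h1 : b < 1) :
    berDiv a b = ENNReal.ofReal (berKL a b / Real.log 2) := by
  rw [berDiv, ENNReal.ofReal_div_of_pos (Real.log_pos one_lt_two), ← toReal_klDiv_ber ha0 ha1 h0 h1,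
    ENNReal.ofReal_toReal (klDiv_ber_ne_top a h0 h1)]

/-- Absolute continuity fails at `false`, which `ber 1` does not charge. -/
theorem berDiv_one_right {a : ℝ} (ha0 : 0 ≤ a) (ha1 : a < 1) : berDiv a 1 = ⊤ := by
  have hn : ¬ ber a ≪ ber 1 := by
    intro h
    have h1 : ber 1 {false} = 0 := by
      rw [← measureReal_eq_zero_iff, ber_real_false zero_le_one le_rfl, sub_self]
    have h2 := ber_real_false ha0 ha1.le
    rw [measureReal_def, h h1] at h2
    simp at h2
    linarith
  rw [berDiv, klDiv_of_not_ac hn, ENNReal.top_div_of_ne_top ENNReal.ofReal_ne_top]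

theorem berDiv_pos {a b : ℝ} (ha0 : 0 ≤ a) (ha1 : a ≤ 1) (h0 : 0 ≤ b) (h1 : b ≤ 1)
    (hab : a ≠ b) : 0 < berDiv a b := by
  rw [berDiv]
  refine ENNReal.div_pos ?_ ENNReal.ofReal_ne_top
  rw [Ne, klDiv_eq_zero_iff]
  intro h
  refine hab ?_
  rw [← ber_real_true ha0 ha1, h, ber_real_true h0 h1]

theorem continuous_berKL_left {b : ℝ} (h0 : 0 < b) (h1 : b < 1) :
    Continuous fun a => berKL a b := by
  -- Splitting the logarithm reduces the claim to continuity of x log x, which covers x = 0 as well.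
  have h : ∀ c : ℝ, c ≠ 0 → (fun x : ℝ => x * Real.log (x / c)) =
      fun x => x * Real.log x - x * Real.log c := by
    intro c hc
    funext x
    rcases eq_or_ne x 0 with rfl | hx
    · simp
    · rw [Real.log_div hx hc]; ring
  have hc : ∀ c : ℝ, c ≠ 0 → Continuous fun x : ℝ => x * Real.log (x / c) := by
    intro c hc
    rw [h c hc]
    exact Real.continuous_mul_log.sub (by fun_prop)
  unfold berKL
  exact (hc b h0.ne').add ((hc (1 - b) (by linarith)).comp (continuous_const.sub continuous_id))

/-! ### The sequence of exponents -/

theorem half_div_nonneg (n : ℕ) : (0 : ℝ) ≤ ((n / 2 : ℕ) : ℝ) / (n : ℝ) := by positivity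

theorem half_div_le (n : ℕ) : ((n / 2 : ℕ) : ℝ) / (n : ℝ) ≤ 1 / 2 := by
  rcases Nat.eq_zero_or_pos n with rfl | hn
  · simp
  · have : (0 : ℝ) < n := by exact_mod_cast hn
    rw [div_le_div_iff₀ this two_pos, one_mul]
    exact_mod_cast Nat.div_mul_le_self n 2

theorem tendsto_half_div :
    Tendsto (fun n : ℕ => ((n / 2 : ℕ) : ℝ) / (n : ℝ)) atTop (𝓝 (1 / 2)) := by
  refine tendsto_of_tendsto_of_tendsto_of_le_of_le' (g := fun n : ℕ => 1 / 2 - 1 / (n : ℝ))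
    (h := fun _ => 1 / 2) ?_ tendsto_const_nhds ?_ (Eventually.of_forall half_div_le)
  · simpa using tendsto_const_nhds.sub (tendsto_one_div_atTop_nhds_zero_nat (𝕜 := ℝ))
  · filter_upwards [eventually_gt_atTop 0] with n hn
    have hn' : (0 : ℝ) < n := by exact_mod_cast hn
    have h : (n : ℝ) ≤ 2 * ((n / 2 : ℕ) : ℝ) + 2 := by
      exact_mod_cast (by omega : n ≤ 2 * (n / 2) + 2)
    rw [sub_le_iff_le_add, ← add_div, div_le_div_iff₀ two_pos hn']
    linarith

theorem tendsto_expo {ρ : ℝ} (h0 : 0 < ρ) (h1 : ρ ≤ 1) :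
    Tendsto (fun n : ℕ => expo n ρ) atTop (𝓝 (berDiv (1 / 2) ρ)) := by
  unfold expo
  rcases h1.lt_or_eq with h1 | rfl
  · have h : ∀ n : ℕ, berDiv (((n / 2 : ℕ) : ℝ) / (n : ℝ)) ρ =
        ENNReal.ofReal (berKL (((n / 2 : ℕ) : ℝ) / (n : ℝ)) ρ / Real.log 2) := fun n =>
      berDiv_eq_ofReal (half_div_nonneg n) ((half_div_le n).trans (by norm_num)) h0 h1
    simp only [h]
    rw [berDiv_eq_ofReal (by norm_num) (by norm_num) h0 h1]
    exact ENNReal.tendsto_ofReal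
      ((((continuous_berKL_left h0 h1).tendsto _).comp tendsto_half_div).div_const _)
  · have h : ∀ n : ℕ, berDiv (((n / 2 : ℕ) : ℝ) / (n : ℝ)) 1 = ⊤ := fun n =>
      berDiv_one_right (half_div_nonneg n) ((half_div_le n).trans_lt (by norm_num))
    simp only [h]
    rw [berDiv_one_right (by norm_num) (by norm_num)]
    exact tendsto_const_nhds

theorem exp2neg_expo_one {n : ℕ} (hn : 1 ≤ n) : exp2neg (n * expo n 1) = 0 := by
  have h : expo n 1 = ⊤ :=
    berDiv_one_right (half_div_nonneg n) ((half_div_le n).trans_lt (by norm_num))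
  rw [h, ENNReal.mul_top (by exact_mod_cast (by omega : n ≠ 0)), exp2neg, if_pos rfl]

theorem exp2neg_nonneg (d : ℝ≥0∞) : 0 ≤ exp2neg d := by
  unfold exp2neg
  split_ifs <;> positivity

theorem exp2neg_expo (n : ℕ) {ρ : ℝ} (h0 : 0 < ρ) (h1 : ρ < 1) :
    exp2neg (n * expo n ρ) = Real.exp (-(n * berKL (((n / 2 : ℕ) : ℝ) / (n : ℝ)) ρ)) := by
  have ha1 : ((n / 2 : ℕ) : ℝ) / (n : ℝ) ≤ 1 := (half_div_le n).trans (by norm_num)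
  have hl : 0 < Real.log 2 := Real.log_pos one_lt_two
  rw [expo, berDiv_eq_ofReal (half_div_nonneg n) ha1 h0 h1, exp2neg,
    if_neg (ENNReal.mul_ne_top (ENNReal.natCast_ne_top n) ENNReal.ofReal_ne_top),
    ENNReal.toReal_mul, ENNReal.toReal_natCast,
    ENNReal.toReal_ofReal (div_nonneg (berKL_nonneg (half_div_nonneg n) ha1 h0 h1) hl.le),
    Real.rpow_def_of_pos two_pos]
  congr 1
  field_simp

theorem exp_neg_mul_log_mul_pow (m : ℕ) {x : ℝ} (h : m = 0 ∨ 0 < x) :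
    Real.exp (-(m * Real.log x)) * x ^ m = 1 := by
  rcases h with rfl | h
  · simp
  · rw [Real.exp_neg, ← Real.log_pow, Real.exp_log (by positivity),
      inv_mul_cancel₀ (by positivity)]

/-- The explicit form of 2^(-n D_n), kept free of division so that it also covers m = 0 (with 0^0 =
1) and ρ = 1. Both main bounds use the exponent through it. -/
theorem exp2neg_expo_mul {n : ℕ} (hn : 1 ≤ n) {ρ : ℝ} (h0 : 0 < ρ) (h1 : ρ ≤ 1) :
    exp2neg (n * expo n ρ) *
        (((n / 2 : ℕ) : ℝ) ^ (n / 2) * ((n - n / 2 : ℕ) : ℝ) ^ (n - n / 2)) =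
      (n : ℝ) ^ n * (ρ ^ (n / 2) * (1 - ρ) ^ (n - n / 2)) := by
  rcases h1.lt_or_eq with h1 | rfl
  · rw [exp2neg_expo n h0 h1]
    have hmn : n / 2 ≤ n := Nat.div_le_self n 2
    have hqpos : 0 < n - n / 2 := by omega
    have hn' : (0 : ℝ) < n := by exact_mod_cast hn
    generalize hm : n / 2 = m at *
    generalize hq : n - m = q at *
    have hsum : (n : ℝ) = m + q := by exact_mod_cast (by omega : n = m + q)
    have h1' : 0 < 1 - ρ := by linarith
    have hq' : (0 : ℝ) < q := by exact_mod_cast hqpos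
    have e1 := exp_neg_mul_log_mul_pow m (x := (m : ℝ) / n / ρ) (by
      rcases Nat.eq_zero_or_pos m with h | h
      · exact Or.inl h
      · right
        have : (0 : ℝ) < m := by exact_mod_cast h
        positivity)
    have e2 := exp_neg_mul_log_mul_pow q (x := (q : ℝ) / n / (1 - ρ)) (Or.inr (by positivity))
    have hD : (n : ℝ) * berKL ((m : ℝ) / n) ρ =
        m * Real.log ((m : ℝ) / n / ρ) + q * Real.log ((q : ℝ) / n / (1 - ρ)) := by
      have : 1 - (m : ℝ) / n = q / n := by field_simp; linarith
      rw [berKL, this]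
      field_simp
    rw [hD, neg_add, Real.exp_add]
    have hmp : (m : ℝ) ^ m = ((m : ℝ) / n / ρ) ^ m * (n ^ m * ρ ^ m) := by
      rw [← mul_pow, ← mul_pow]; congr 1; field_simp
    have hqp : (q : ℝ) ^ q = ((q : ℝ) / n / (1 - ρ)) ^ q * (n ^ q * (1 - ρ) ^ q) := by
      rw [← mul_pow, ← mul_pow]; congr 1; field_simp
    have hnn : (n : ℝ) ^ n = n ^ m * n ^ q := by rw [← pow_add]; congr 1; omega
    rw [hmp, hqp, hnn]
    linear_combination (n ^ m * ρ ^ m * n ^ q * (1 - ρ) ^ q : ℝ) *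
      (Real.exp (-(q * Real.log (q / n / (1 - ρ)))) * (q / n / (1 - ρ)) ^ q * e1 + e2)
  · rw [exp2neg_expo_one hn, sub_self, zero_pow (by omega)]
    simp

theorem half_pow_pos (n : ℕ) :
    (0 : ℝ) < ((n / 2 : ℕ) : ℝ) ^ (n / 2) * ((n - n / 2 : ℕ) : ℝ) ^ (n - n / 2) := by
  have h : ∀ a : ℕ, (0 : ℝ) < (a : ℝ) ^ a := fun a => by exact_mod_cast Nat.pow_self_pos
  exact mul_pos (h _) (h _)

theorem exp2neg_expo_le_choose {n : ℕ} (hn : 1 ≤ n) {ρ : ℝ} (h0 : 0 < ρ) (h1 : ρ ≤ 1) :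
    1 / ((n : ℝ) + 1) * exp2neg (n * expo n ρ) ≤
      n.choose (n / 2) * (ρ ^ (n / 2) * (1 - ρ) ^ (n - n / 2)) := by
  rw [one_div, inv_mul_le_iff₀ (by positivity)]
  refine le_of_mul_le_mul_right ?_ (half_pow_pos n)
  rw [exp2neg_expo_mul hn h0 h1]
  have h : (n : ℝ) ^ n ≤ (n + 1) * (((n / 2 : ℕ) : ℝ) ^ (n / 2) *
      ((n - n / 2 : ℕ) : ℝ) ^ (n - n / 2) * n.choose (n / 2)) := by
    exact_mod_cast pow_self_le_choose n (n / 2) (Nat.div_le_self n 2)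
  have h1' : 0 ≤ 1 - ρ := by linarith
  refine (mul_le_mul_of_nonneg_right h (by positivity)).trans_eq ?_
  ring

theorem berKL_half_pos {ρ : ℝ} (hρ : 1 / 2 < ρ) (h1 : ρ < 1) : 0 < berKL (1 / 2) ρ := by
  have h := berDiv_pos (a := 1 / 2) (b := ρ) (by norm_num) (by norm_num) (by linarith) h1.le hρ.ne
  rw [berDiv_eq_ofReal (by norm_num) (by norm_num) (by linarith) h1, ENNReal.ofReal_pos] at h
  exact (div_pos_iff_of_pos_right (Real.log_pos one_lt_two)).1 h

theorem tendsto_berKL_half {ρ : ℝ} (h0 : 0 < ρ) (h1 : ρ < 1) :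
    Tendsto (fun n : ℕ => berKL (((n / 2 : ℕ) : ℝ) / (n : ℝ)) ρ) atTop (𝓝 (berKL (1 / 2) ρ)) :=
  ((continuous_berKL_left h0 h1).tendsto _).comp tendsto_half_div

theorem tendsto_exp2neg_expo {ρ : ℝ} (hρ : 1 / 2 < ρ) (h1 : ρ ≤ 1) :
    Tendsto (fun n : ℕ => exp2neg (n * expo n ρ)) atTop (𝓝 0) := by
  rcases h1.lt_or_eq with h1 | rfl
  · simp only [exp2neg_expo _ (by linarith : 0 < ρ) h1]
    refine Real.tendsto_exp_atBot.comp (tendsto_neg_atTop_atBot.comp ?_)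
    exact tendsto_natCast_atTop_atTop.atTop_mul_pos (berKL_half_pos hρ h1)
      (tendsto_berKL_half (by linarith) h1)
  · refine tendsto_const_nhds.congr' ?_
    filter_upwards [eventually_ge_atTop 1] with n hn
    rw [exp2neg_expo_one hn]

/-- After taking -(1/n) log, the constants and the factor 1/(n+1) contribute terms that vanish, so
both bounds tend to the limit of D_n. -/
theorem hasExpRate_of_bounds {ρ : ℝ} (h0 : 0 < ρ) (h1 : ρ ≤ 1) {A : ℕ → ℝ} {c C : ℝ}
    (hc : 0 < c)
    (hl : ∀ n : ℕ, 1 ≤ n → 1 / ((n : ℝ) + 1) * exp2neg (n * expo n ρ) * c ≤ A n)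
    (hu : ∀ n : ℕ, 1 ≤ n → A n ≤ exp2neg (n * expo n ρ) * C) :
    HasExpRate A (berDiv (1 / 2) ρ) := by
  unfold HasExpRate
  rcases h1.lt_or_eq with h1 | rfl
  · have hlog2 : 0 < Real.log 2 := Real.log_pos one_lt_two
    set D : ℕ → ℝ := fun n => berKL (((n / 2 : ℕ) : ℝ) / (n : ℝ)) ρ with hD
    have hE : ∀ n : ℕ, exp2neg (n * expo n ρ) = Real.exp (-(n * D n)) :=
      fun n => exp2neg_expo n h0 h1
    simp only [hE] at hl hu
    have hApos : ∀ n, 1 ≤ n → 0 < A n := fun n hn => lt_of_lt_of_le (by positivity) (hl n hn)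
    -- Positivity of C comes from comparing the two bounds at n = 1.
    have hC : 0 < C := by
      have := (hApos 1 le_rfl).trans_le (hu 1 le_rfl)
      exact pos_of_mul_pos_right this (Real.exp_pos _).le
    have hkl : 0 ≤ berKL (1 / 2) ρ := berKL_nonneg (by norm_num) (by norm_num) h0 h1
    rw [berDiv_eq_ofReal (by norm_num) (by norm_num) h0 h1, EReal.coe_ennreal_ofReal,
      max_eq_left (by positivity)]
    have hreal : Tendsto (fun n : ℕ => -(1 / (n : ℝ) * Real.logb 2 (A n))) atTop
        (𝓝 (berKL (1 / 2) ρ / Real.log 2)) := by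
      have hinv := tendsto_one_div_atTop_nhds_zero_nat (𝕜 := ℝ)
      have hlog : Tendsto (fun n : ℕ => 1 / (n : ℝ) * Real.log ((n : ℝ) + 1)) atTop (𝓝 0) := by
        have h := (Real.isLittleO_log_id_atTop.tendsto_div_nhds_zero).comp
          (tendsto_atTop_add_const_right _ (1 : ℝ) (tendsto_natCast_atTop_atTop (R := ℝ)))
        have h2 : Tendsto (fun n : ℕ => ((n : ℝ) + 1) / n) atTop (𝓝 1) := by
          have h3 : Tendsto (fun n : ℕ => 1 + 1 / (n : ℝ)) atTop (𝓝 1) := by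
            simpa using hinv.const_add 1
          refine h3.congr' ?_
          filter_upwards [eventually_gt_atTop 0] with n hn
          have : (n : ℝ) ≠ 0 := by exact_mod_cast hn.ne'
          field_simp
        have h4 := h.mul h2
        rw [zero_mul] at h4
        refine h4.congr fun n => ?_
        simp only [Function.comp, id]
        have : (n : ℝ) + 1 ≠ 0 := by positivity
        field_simp
      have hlow : Tendsto (fun n : ℕ => (D n - 1 / (n : ℝ) * Real.log C) / Real.log 2) atTop
          (𝓝 (berKL (1 / 2) ρ / Real.log 2)) := by
        simpa using ((tendsto_berKL_half h0 h1).sub (hinv.mul_const (Real.log C))).div_const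
          (Real.log 2)
      have hup : Tendsto (fun n : ℕ => (D n + 1 / (n : ℝ) * Real.log ((n : ℝ) + 1)
          - 1 / (n : ℝ) * Real.log c) / Real.log 2) atTop (𝓝 (berKL (1 / 2) ρ / Real.log 2)) := by
        simpa using (((tendsto_berKL_half h0 h1).add hlog).sub
          (hinv.mul_const (Real.log c))).div_const (Real.log 2)
      refine tendsto_of_tendsto_of_tendsto_of_le_of_le' hlow hup ?_ ?_
      · filter_upwards [eventually_ge_atTop 1] with n hn
        have hn' : (0 : ℝ) < n := by exact_mod_cast hn
        have h := Real.log_le_log (hApos n hn) (hu n hn)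
        rw [Real.log_mul (Real.exp_pos _).ne' hC.ne', Real.log_exp] at h
        have h' : (n : ℝ) * D n - Real.log C ≤ - Real.log (A n) := by linarith
        calc _ = 1 / (n * Real.log 2) * ((n : ℝ) * D n - Real.log C) := by field_simp
          _ ≤ 1 / (n * Real.log 2) * (- Real.log (A n)) := by gcongr
          _ = _ := by rw [Real.logb]; field_simp
      · filter_upwards [eventually_ge_atTop 1] with n hn
        have hn' : (0 : ℝ) < n := by exact_mod_cast hn
        have h := Real.log_le_log (by positivity) (hl n hn)
        rw [Real.log_mul (by positivity) hc.ne', Real.log_mul (by positivity) (by positivity),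
          Real.log_exp, one_div, Real.log_inv] at h
        have h' : - Real.log (A n) ≤ (n : ℝ) * D n + Real.log (n + 1) - Real.log c := by linarith
        calc _ = 1 / (n * Real.log 2) * (- Real.log (A n)) := by rw [Real.logb]; field_simp
          _ ≤ 1 / (n * Real.log 2) * ((n : ℝ) * D n + Real.log (n + 1) - Real.log c) := by gcongr
          _ = _ := by field_simp
    refine (continuous_coe_real_ereal.continuousAt.tendsto.comp hreal).congr' ?_
    filter_upwards [eventually_ge_atTop 1] with n hn
    simp only [Function.comp, log2, if_neg (hApos n hn).not_ge]
    push_cast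
    rfl
  · rw [berDiv_one_right (by norm_num) (by norm_num)]
    refine tendsto_const_nhds.congr' ?_
    filter_upwards [eventually_ge_atTop 1] with n hn
    -- At ρ = 1 the upper bound gives A n ≤ 0, so `log2` is ⊥ and the rate is ⊤ for every n ≥ 1.
    have h := hu n hn
    rw [exp2neg_expo_one hn, zero_mul] at h
    have hn' : (0 : ℝ) < 1 / (n : ℝ) := by
      have : (0 : ℝ) < n := by exact_mod_cast hn
      positivity
    rw [log2, if_pos h, EReal.coe_mul_bot_of_pos hn']
    simp

/-! ### Error probabilities -/

theorem errorProb_eq [Fintype 𝒳] [Fintype 𝒪] (P : 𝒳 → ℝ) {K : 𝒳 → 𝒪 → ℝ}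
    (hK : IsStochastic K) (g : 𝒪 → 𝒳) :
    errorProb P K g = ∑ x, P x - ∑ o, P (g o) * K (g o) o := by
  classical
  have h1 : ∑ x, P x = ∑ x, ∑ o, P x * K x o := by
    refine sum_congr rfl fun x _ => ?_
    rw [← mul_sum, hK.2 x, mul_one]
  have h2 : ∑ o, P (g o) * K (g o) o = ∑ x, ∑ o, if g o = x then P x * K x o else 0 := by
    rw [sum_comm]
    simp
  rw [errorProb, h1, h2, ← sum_sub_distrib]
  refine sum_congr rfl fun x _ => ?_
  rw [← sum_sub_distrib]
  refine sum_congr rfl fun o _ => ?_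
  by_cases h : g o = x <;> simp [h]

theorem privacy_le_errorProb [Fintype 𝒳] [Fintype 𝒪] (P : 𝒳 → ℝ) (K : 𝒳 → 𝒪 → ℝ)
    (g : 𝒪 → 𝒳) : privacy P K ≤ errorProb P K g := by
  classical
  exact ciInf_le (Set.finite_range _).bddBelow g

theorem isStochastic_prodChannel {W : Fin n → 𝒳 → Fin k → ℝ} (hW : ∀ t, IsStochastic (W t)) :
    IsStochastic (prodChannel W) := by
  refine ⟨fun x z => prod_nonneg fun t _ => (hW t).1 x _, fun x => ?_⟩
  have h := Finset.prod_univ_sum (fun _ : Fin n => (univ : Finset (Fin k))) fun t i => W t x i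
  rw [Fintype.piFinset_univ] at h
  unfold prodChannel
  rw [← h]
  exact prod_eq_one fun t _ => (hW t).2 x

theorem exists_eq_pStar [Fintype 𝒳] (P : 𝒳 → ℝ) {f : 𝒳 → Fin k} (hf : Function.Surjective f)
    (i : Fin k) : ∃ x, f x = i ∧ P x = pStar P f i := by
  obtain ⟨x, hx⟩ := hf i
  have : Nonempty {x : 𝒳 // f x = i} := ⟨⟨x, hx⟩⟩
  obtain ⟨y, hy⟩ := exists_eq_ciSup_of_finite (f := fun x : {x : 𝒳 // f x = i} => P x)
  exact ⟨y, y.2, hy⟩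

theorem le_pStar [Fintype 𝒳] (P : 𝒳 → ℝ) (f : 𝒳 → Fin k) (x : 𝒳) : P x ≤ pStar P f (f x) :=
  le_ciSup (f := fun y : {y : 𝒳 // f y = f x} => P y) (Set.finite_range _).bddAbove ⟨x, rfl⟩

/-! ### Upper bound by majority decoding -/

/-- Chernoff's argument: s^m is at most s^N when N ≤ m hits of i occur. The mean of s^N factors over
t into terms 1 - w t i (1 - s), each largest at w t i = ρ. -/
theorem sum_prod_mul_pow_le {ρ s : ℝ} (hs0 : 0 ≤ s) (hs1 : s ≤ 1) {w : Fin n → Fin k → ℝ}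
    (hw0 : ∀ t i, 0 ≤ w t i) (hw1 : ∀ t, ∑ i, w t i = 1) (i : Fin k) (hρ : ∀ t, ρ ≤ w t i)
    (m : ℕ) :
    (∑ z : Fin n → Fin k with #{t | z t = i} ≤ m, ∏ t, w t (z t)) * s ^ m ≤
      (1 - ρ + ρ * s) ^ n := by
  have hstep : ∀ z : Fin n → Fin k, (∏ t, w t (z t)) * s ^ #{t | z t = i} =
      ∏ t, w t (z t) * if z t = i then s else 1 := by
    intro z
    rw [prod_mul_distrib, prod_ite, prod_const_one, prod_const, mul_one]
  have h := Finset.prod_univ_sum (fun _ : Fin n => (univ : Finset (Fin k)))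
    fun t j => w t j * if j = i then s else 1
  rw [Fintype.piFinset_univ] at h
  rw [sum_mul]
  calc _ ≤ ∑ z : Fin n → Fin k with #{t | z t = i} ≤ m, (∏ t, w t (z t)) * s ^ #{t | z t = i} := by
        refine sum_le_sum fun z hz => ?_
        exact mul_le_mul_of_nonneg_left (pow_le_pow_of_le_one hs0 hs1 (mem_filter.1 hz).2)
          (prod_nonneg fun t _ => hw0 _ _)
    _ ≤ ∑ z : Fin n → Fin k, (∏ t, w t (z t)) * s ^ #{t | z t = i} :=
        sum_le_sum_of_subset_of_nonneg (filter_subset _ _) fun z _ _ =>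
          mul_nonneg (prod_nonneg fun t _ => hw0 _ _) (pow_nonneg hs0 _)
    _ = ∏ t, ∑ j, w t j * if j = i then s else 1 := by
        rw [h]; exact sum_congr rfl fun z _ => hstep z
    _ ≤ ∏ _t : Fin n, (1 - ρ + ρ * s) := by
        refine prod_le_prod (fun t _ => sum_nonneg fun j _ => mul_nonneg (hw0 _ _) ?_) fun t _ => ?_
        · split_ifs <;> linarith
        · have : ∑ j, w t j * (if j = i then s else 1) = 1 - w t i * (1 - s) := by
            have : ∀ j, w t j * (if j = i then s else 1) =
                w t j - if j = i then w t j * (1 - s) else 0 := by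
              intro j; split_ifs <;> ring
            simp only [this, sum_sub_distrib, hw1, sum_ite_eq', mem_univ, if_true]
          rw [this]
          nlinarith [hρ t]
    _ = _ := by simp

theorem sum_prod_le_exp2neg {ρ : ℝ} (hρ0 : 1 / 2 < ρ) (hρ1 : ρ ≤ 1) (hn : 1 ≤ n)
    {w : Fin n → Fin k → ℝ}
    (hw0 : ∀ t i, 0 ≤ w t i) (hw1 : ∀ t, ∑ i, w t i = 1) (i : Fin k) (hρ : ∀ t, ρ ≤ w t i) :
    ∑ z : Fin n → Fin k with #{t | z t = i} ≤ n / 2, ∏ t, w t (z t) ≤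
      exp2neg (n * expo n ρ) := by
  rcases hρ1.lt_or_eq with hlt | rfl
  · refine le_of_mul_le_mul_right ?_ (half_pow_pos n)
    rw [exp2neg_expo_mul hn (by linarith) hρ1]
    have hqpos : 0 < n - n / 2 := by omega
    have hle : n / 2 ≤ n - n / 2 := by omega
    have hnq : n = n / 2 + (n - n / 2) := by omega
    have key : ∀ s : ℝ, 0 ≤ s → s ≤ 1 → _ := fun s h h' =>
      sum_prod_mul_pow_le h h' hw0 hw1 i hρ (n / 2)
    set B := ∑ z : Fin n → Fin k with #{t | z t = i} ≤ n / 2, ∏ t, w t (z t)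
    generalize n / 2 = m at *
    generalize n - m = q at *
    have hq : (0 : ℝ) < q := by exact_mod_cast hqpos
    have hmq : (m : ℝ) ≤ q := by exact_mod_cast hle
    have h1 : 0 < 1 - ρ := by linarith
    have hρ' : 0 < ρ := by linarith
    -- The optimal tilt, turning a Ber(ρ) hit into a Ber(m/n) one. It is at most 1 because m ≤ n - m
    -- and 1 - ρ ≤ ρ.
    have hk := key (m * (1 - ρ) / (q * ρ)) (by positivity) (by
      rw [div_le_one (by positivity)]
      exact mul_le_mul hmq (by linarith) h1.le hq.le)
    have hN : (n : ℝ) = m + q := by exact_mod_cast hnq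
    have he : 1 - ρ + ρ * (m * (1 - ρ) / (q * ρ)) = (1 - ρ) * n / q := by
      rw [hN]; field_simp; ring
    have e1 : ((1 - ρ) * (n : ℝ) / q) ^ n = (1 - ρ) ^ m * (1 - ρ) ^ q * n ^ n / (q ^ m * q ^ q) := by
      rw [div_pow, mul_pow]
      congr 1
      · rw [← pow_add, ← hnq]
      · rw [← pow_add, ← hnq]
    rw [he, e1, div_pow, mul_pow, mul_pow, mul_div_assoc', div_le_div_iff₀ (by positivity)
      (by positivity)] at hk
    refine le_of_mul_le_mul_right ?_ (by positivity : (0 : ℝ) < (1 - ρ) ^ m * q ^ m)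
    calc _ = B * ((m : ℝ) ^ m * (1 - ρ) ^ m) * (q ^ m * q ^ q) := by ring
      _ ≤ _ := hk
      _ = _ := by ring
  · rw [exp2neg_expo_one hn]
    refine le_of_eq (sum_eq_zero fun z hz => ?_)
    have hz' := (mem_filter.1 hz).2
    -- At most n/2 < n hits force a miss, and for ρ = 1 a miss has probability zero.
    obtain ⟨t, ht⟩ : ∃ t, z t ≠ i := by
      by_contra! h
      rw [filter_true_of_mem fun t _ => h t, card_univ, Fintype.card_fin] at hz'
      omega
    refine prod_eq_zero (mem_univ t) (le_antisymm ?_ (hw0 _ _))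
    have h := sum_le_univ_sum_of_nonneg (s := {z t, i}) (hw0 t)
    rw [hw1, sum_pair ht] at h
    linarith [hρ t]

theorem eq_of_half_lt_card {z : Fin n → Fin k} {i j : Fin k} (hi : n / 2 < #{t | z t = i})
    (hj : n / 2 < #{t | z t = j}) : i = j := by
  by_contra hij
  have hd : Disjoint ({t | z t = i} : Finset (Fin n)) ({t | z t = j} : Finset (Fin n)) := by
    rw [disjoint_filter]
    rintro t - h h'
    exact hij (h.symm.trans h')
  have h := card_le_univ (({t | z t = i} : Finset (Fin n)) ∪ ({t | z t = j} : Finset (Fin n)))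
  rw [card_union_of_disjoint hd, Fintype.card_fin] at h
  omega

theorem privacy_prodChannel_le [Fintype 𝒳] {P : 𝒳 → ℝ} (hP_pos : ∀ x, 0 < P x)
    (hP_sum : ∑ x, P x = 1) {f : 𝒳 → Fin k} (hf : Function.Surjective f) (hk : 0 < k) {ρ : ℝ}
    (hρ0 : 1 / 2 < ρ) (hρ1 : ρ ≤ 1) (hn : 1 ≤ n) {W : Fin n → 𝒳 → Fin k → ℝ}
    (hW : ∀ t, IsQR f ρ (W t)) :
    privacy P (prodChannel W) ≤
      1 - ∑ i, pStar P f i + exp2neg (n * expo n ρ) * ∑ i, pStar P f i := by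
  classical
  choose xs hxf hxP using exists_eq_pStar P hf
  have hst := isStochastic_prodChannel fun t => (hW t).1
  -- The default symbol is harmless: only outputs with a strict majority are counted as correct.
  let maj : (Fin n → Fin k) → Fin k := fun z =>
    if h : ∃ i, n / 2 < #{t | z t = i} then h.choose else ⟨0, hk⟩
  have hmaj : ∀ z i, n / 2 < #{t | z t = i} → i = maj z := by
    intro z i hi
    have h : ∃ i, n / 2 < #{t | z t = i} := ⟨i, hi⟩
    simp only [maj, dif_pos h]
    exact eq_of_half_lt_card hi h.choose_spec
  refine (privacy_le_errorProb P _ fun z => xs (maj z)).trans ?_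
  rw [errorProb_eq P hst, hP_sum]
  have hbad : ∀ i, ∑ z : Fin n → Fin k with #{t | z t = i} ≤ n / 2, prodChannel W (xs i) z ≤
      exp2neg (n * expo n ρ) := fun i =>
    sum_prod_le_exp2neg hρ0 hρ1 hn (fun t j => (hW t).1.1 _ _) (fun t => (hW t).1.2 _) i
      fun t => by simpa [hxf] using (hW t).2 (xs i)
  have hgood : ∀ i, 1 - exp2neg (n * expo n ρ) ≤
      ∑ z : Fin n → Fin k with n / 2 < #{t | z t = i}, prodChannel W (xs i) z := by
    intro i
    have h := sum_filter_add_sum_filter_not univ (fun z : Fin n → Fin k => #{t | z t = i} ≤ n / 2)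
      fun z => prodChannel W (xs i) z
    simp only [not_le] at h
    rw [hst.2] at h
    linarith [hbad i]
  have hmain : ∑ i, pStar P f i * (1 - exp2neg (n * expo n ρ)) ≤
      ∑ z, P (xs (maj z)) * prodChannel W (xs (maj z)) z := by
    calc _ ≤ ∑ i, P (xs i) *
          ∑ z : Fin n → Fin k with n / 2 < #{t | z t = i}, prodChannel W (xs i) z := by
          refine sum_le_sum fun i _ => ?_
          rw [← hxP]
          exact mul_le_mul_of_nonneg_left (hgood i) (hP_pos _).le
      _ = ∑ z : Fin n → Fin k, ∑ i, if n / 2 < #{t | z t = i} then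
            P (xs i) * prodChannel W (xs i) z else 0 := by
          rw [sum_comm]
          refine sum_congr rfl fun i _ => ?_
          rw [mul_sum, sum_filter]
      _ ≤ ∑ z : Fin n → Fin k, ∑ i, if i = maj z then P (xs i) * prodChannel W (xs i) z else 0 := by
          refine sum_le_sum fun z _ => sum_le_sum fun i _ => ?_
          have h0 : 0 ≤ P (xs i) * prodChannel W (xs i) z :=
            mul_nonneg (hP_pos _).le (hst.1 _ _)
          by_cases h : n / 2 < #{t | z t = i}
          · rw [if_pos h, if_pos (hmaj z i h)]
          · rw [if_neg h]
            split_ifs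
            exacts [h0, le_rfl]
      _ = _ := by simp
  rw [← sum_mul] at hmain
  linarith

/-! ### Lower bound by confusing pairs of symbols -/

theorem isQR_V₁ (hk : 2 ≤ k) (f : 𝒳 → Fin k) {ρ : ℝ} (h0 : 0 ≤ ρ) (h1 : ρ ≤ 1) :
    IsQR f ρ fun x i => V₁ k ρ (f x) i := by
  refine ⟨⟨fun x i => ?_, fun x => ?_⟩, fun x => by simp [V₁]⟩
  · simp only [V₁]
    split_ifs <;> linarith
  -- Each row has a single off-diagonal target p. For an even last symbol it wraps to 0, distinct
  -- from the symbol itself since k ≥ 2.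
  · obtain ⟨p, hp⟩ : ∃ p : Fin k, p ≠ f x ∧ ∀ i : Fin k,
        ((Even (f x : ℕ) ∧ (i : ℕ) = (f x + 1) % k) ∨ (Odd (f x : ℕ) ∧ (i : ℕ) + 1 = f x)) ↔
          i = p := by
      have hlt := (f x).2
      rcases Nat.even_or_odd (f x : ℕ) with he | ho
      · refine ⟨⟨((f x : ℕ) + 1) % k, Nat.mod_lt _ (by omega)⟩, ?_, fun i => ?_⟩
        · intro h
          have h' := congrArg Fin.val h
          simp only at h'
          rcases (Nat.succ_le_of_lt hlt).lt_or_eq with h2 | h2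
          · rw [Nat.mod_eq_of_lt h2] at h'; omega
          · rw [show (f x : ℕ) + 1 = k from h2, Nat.mod_self] at h'; omega
        · simp [he, Fin.ext_iff, Nat.not_odd_iff_even.2 he]
      · have hpos := ho.pos
        refine ⟨⟨(f x : ℕ) - 1, by omega⟩, ?_, fun i => ?_⟩
        · simp only [ne_eq, Fin.ext_iff]; omega
        · simp only [ho, Nat.not_even_iff_odd.2 ho, Fin.ext_iff, false_and, true_and, false_or]
          omega
    have : ∀ i, V₁ k ρ (f x) i = (if i = f x then ρ else 0) + if i = p then 1 - ρ else 0 := by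
      intro i
      unfold V₁
      simp only [hp.2 i]
      by_cases h : i = f x
      · have : i ≠ p := fun h' => hp.1 (h'.symm.trans h)
        simp [h, hp.1.symm]
      · simp [h]
    simp [this, sum_add_distrib]

/-- For even i, bound each minimum by its odd entry. For odd i, bound the i-th minimum by the even
entry a (p i) instead, leaving a i free. Only parity matters; p need not be injective. -/
theorem add_sum_min_le {a : Fin k → ℝ} (ha : ∀ i, 0 ≤ a i) (p : Fin k → Fin k)
    (hp : ∀ j : Fin k, Odd j.val → Even (p j : ℕ)) (i : Fin k) :
    a i + ∑ j : Fin k with Odd j.val, min (a (p j)) (a j) ≤ ∑ j, a j := by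
  by_cases hi : Odd (i : ℕ)
  · have hpi := hp i hi
    have h1 : ∑ j : Fin k with Odd j.val, min (a (p j)) (a j) ≤
        a (p i) + ∑ j ∈ ({j : Fin k | Odd j.val} : Finset (Fin k)).erase i, a j := by
      rw [← add_sum_erase _ _ (mem_filter.2 ⟨mem_univ i, hi⟩)]
      exact add_le_add (min_le_left _ _) (sum_le_sum fun j _ => min_le_right _ _)
    have h2 : a i + ∑ j ∈ ({j : Fin k | Odd j.val} : Finset (Fin k)).erase i, a j =
        ∑ j : Fin k with Odd j.val, a j := add_sum_erase _ _ (mem_filter.2 ⟨mem_univ i, hi⟩)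
    have h3 : a (p i) ≤ ∑ j : Fin k with ¬ Odd j.val, a j :=
      single_le_sum (f := a) (fun j _ => ha j)
        (mem_filter.2 ⟨mem_univ _, Nat.not_odd_iff_even.2 hpi⟩)
    have h4 := sum_filter_add_sum_filter_not univ (fun j : Fin k => Odd j.val) a
    linarith
  · have h1 : ∑ j : Fin k with Odd j.val, min (a (p j)) (a j) ≤
        ∑ j : Fin k with Odd j.val, a j := sum_le_sum fun j _ => min_le_right _ _
    have h3 : a i ≤ ∑ j : Fin k with ¬ Odd j.val, a j :=
      single_le_sum (f := a) (fun j _ => ha j) (mem_filter.2 ⟨mem_univ _, hi⟩)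
    have h4 := sum_filter_add_sum_filter_not univ (fun j : Fin k => Odd j.val) a
    linarith

/-- The predecessor of a symbol, with the junk value `j` at `j = 0`. -/
def predSymbol (j : Fin k) : Fin k := ⟨(j : ℕ) - 1, by omega⟩

/-- Restrict the sum to sequences over {j - 1, j} with exactly ⌊n/2⌋ copies of j, indexed by the
positions of j. -/
theorem le_sum_min_prod_V₁ {ρ : ℝ} (hρ0 : 1 / 2 ≤ ρ) (hρ1 : ρ ≤ 1) {p q : ℝ} (hp : 0 ≤ p)
    (hq : 0 ≤ q) {j : Fin k} (hj : Odd j.val) :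
    n.choose (n / 2) * (ρ ^ (n / 2) * (1 - ρ) ^ (n - n / 2)) * min p q ≤
      ∑ z : Fin n → Fin k, min (p * ∏ t, V₁ k ρ (predSymbol j) (z t))
        (q * ∏ t, V₁ k ρ j (z t)) := by
  classical
  have hjpos := hj.pos
  have hjk := j.2
  have hpv : ((predSymbol j : Fin k) : ℕ) = j - 1 := rfl
  have hpj : predSymbol j ≠ j := by rw [Ne, Fin.ext_iff, hpv]; omega
  have heven : Even ((predSymbol j : Fin k) : ℕ) := by
    rw [hpv]; exact Nat.Odd.sub_odd hj odd_one
  have h1 : 0 ≤ 1 - ρ := by linarith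
  have h0 : 0 ≤ ρ := by linarith
  have v1 : V₁ k ρ j j = ρ := by simp [V₁]
  have v2 : V₁ k ρ (predSymbol j) (predSymbol j) = ρ := by simp [V₁]
  have v3 : V₁ k ρ j (predSymbol j) = 1 - ρ := by
    rw [V₁, if_neg hpj, if_pos (Or.inr ⟨hj, by rw [hpv]; omega⟩)]
  have v4 : V₁ k ρ (predSymbol j) j = 1 - ρ := by
    have h : (j : ℕ) = ((predSymbol j : ℕ) + 1) % k := by
      rw [hpv, Nat.sub_add_cancel hjpos, Nat.mod_eq_of_lt hjk]
    rw [V₁, if_neg hpj.symm, if_pos (Or.inl ⟨heven, h⟩)]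
  have vnn : ∀ a b, 0 ≤ V₁ k ρ a b := by
    intro a b; unfold V₁; split_ifs <;> linarith
  let seq : Finset (Fin n) → Fin n → Fin k := fun A t => if t ∈ A then j else predSymbol j
  have hinj : Function.Injective seq := by
    intro A B h
    ext t
    have ht := congrFun h t
    by_cases hA : t ∈ A <;> by_cases hB : t ∈ B <;> simp_all [seq, hpj.symm]
  have hprod : ∀ (A : Finset (Fin n)) (a b : ℝ), #A = n / 2 →
      ∏ t, (if t ∈ A then a else b) = a ^ (n / 2) * b ^ (n - n / 2) := by
    intro A a b hA
    rw [prod_ite, prod_const, prod_const, filter_mem_eq_inter, univ_inter, hA,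
      filter_not, filter_mem_eq_inter, univ_inter, card_sdiff_of_subset (subset_univ _), hA, card_univ, Fintype.card_fin]
  calc _ = ∑ A ∈ powersetCard (n / 2) (univ : Finset (Fin n)),
          min p q * (ρ ^ (n / 2) * (1 - ρ) ^ (n - n / 2)) := by
        rw [sum_const, card_powersetCard, card_univ, Fintype.card_fin, nsmul_eq_mul]; ring
    _ ≤ ∑ A ∈ powersetCard (n / 2) (univ : Finset (Fin n)),
          min (p * ∏ t, V₁ k ρ (predSymbol j) (seq A t)) (q * ∏ t, V₁ k ρ j (seq A t)) := by
        refine sum_le_sum fun A hA => ?_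
        have hA' := (mem_powersetCard.1 hA).2
        have e1 : ∏ t, V₁ k ρ (predSymbol j) (seq A t) =
            (1 - ρ) ^ (n / 2) * ρ ^ (n - n / 2) := by
          rw [← hprod A _ _ hA']
          refine prod_congr rfl fun t _ => ?_
          simp only [seq]; split_ifs <;> assumption
        have e2 : ∏ t, V₁ k ρ j (seq A t) = ρ ^ (n / 2) * (1 - ρ) ^ (n - n / 2) := by
          rw [← hprod A _ _ hA']
          refine prod_congr rfl fun t _ => ?_
          simp only [seq]; split_ifs <;> assumption
        -- Since j is not in the majority and ρ ≥ 1 - ρ, the likelihood under j is the smaller of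
        -- the two.
        have hswap : ρ ^ (n / 2) * (1 - ρ) ^ (n - n / 2) ≤
            (1 - ρ) ^ (n / 2) * ρ ^ (n - n / 2) := by
          obtain ⟨d, hd⟩ : ∃ d, n - n / 2 = n / 2 + d := ⟨n - n / 2 - n / 2, by omega⟩
          rw [hd, pow_add, pow_add]
          calc _ = ρ ^ (n / 2) * (1 - ρ) ^ (n / 2) * (1 - ρ) ^ d := by ring
            _ ≤ ρ ^ (n / 2) * (1 - ρ) ^ (n / 2) * ρ ^ d := by
              gcongr; linarith
            _ = _ := by ring
        rw [e1, e2]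
        refine le_min (mul_le_mul (min_le_left _ _) hswap (by positivity) hp) ?_
        exact mul_le_mul_of_nonneg_right (min_le_right _ _) (by positivity)
    _ = ∑ z ∈ (powersetCard (n / 2) (univ : Finset (Fin n))).map ⟨seq, hinj⟩,
          min (p * ∏ t, V₁ k ρ (predSymbol j) (z t)) (q * ∏ t, V₁ k ρ j (z t)) := by
        rw [sum_map]; rfl
    _ ≤ _ := sum_le_sum_of_subset_of_nonneg (subset_univ _) fun z _ _ =>
        le_min (mul_nonneg hp (prod_nonneg fun _ _ => vnn _ _))
          (mul_nonneg hq (prod_nonneg fun _ _ => vnn _ _))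

theorem pStar_nonneg [Fintype 𝒳] {P : 𝒳 → ℝ} (hP : ∀ x, 0 < P x) (f : 𝒳 → Fin k) (i : Fin k) :
    0 ≤ pStar P f i :=
  Real.iSup_nonneg fun x => (hP x).le

theorem le_addNoisePrivacy [Fintype 𝒳] [Nonempty 𝒳] {P : 𝒳 → ℝ} (hP_pos : ∀ x, 0 < P x)
    (hP_sum : ∑ x, P x = 1) (f : 𝒳 → Fin k) (hk : 2 ≤ k) {ρ : ℝ}
    (hρ0 : 1 / 2 < ρ) (hρ1 : ρ ≤ 1) (hn : 1 ≤ n) :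
    1 - ∑ i, pStar P f i + 1 / ((n : ℝ) + 1) * exp2neg (n * expo n ρ) *
        ∑ j : Fin k with Odd j.val, min (pStar P f (predSymbol j)) (pStar P f j) ≤
      addNoisePrivacy P f n (V₁ k ρ) := by
  unfold addNoisePrivacy privacy
  refine le_ciInf fun g => ?_
  have hqr := isQR_V₁ hk f (by linarith : 0 ≤ ρ) hρ1
  rw [errorProb_eq P (isStochastic_prodChannel fun _ => hqr.1), hP_sum]
  let a : (Fin n → Fin k) → Fin k → ℝ := fun z i => pStar P f i * ∏ t, V₁ k ρ i (z t)
  have vnn : ∀ a b, 0 ≤ V₁ k ρ a b := by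
    intro a b; unfold V₁; split_ifs <;> linarith
  have ha : ∀ z i, 0 ≤ a z i := fun z i =>
    mul_nonneg (pStar_nonneg hP_pos f i) (prod_nonneg fun _ _ => vnn _ _)
  have hrow : ∀ i, ∑ z, a z i = pStar P f i := by
    intro i
    have h := (isStochastic_prodChannel (𝒳 := Fin k) (n := n) fun _ =>
      (isQR_V₁ hk id (by linarith : 0 ≤ ρ) hρ1).1).2 i
    simp only [a, ← mul_sum]
    simp only [prodChannel, id] at h
    rw [h, mul_one]
  -- The guessed point weighs no more than the best point of its fibre, so the bound on pairs
  -- applies with i = f (g z).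
  have hz : ∀ z, P (g z) * prodChannel (fun _ : Fin n => fun x i => V₁ k ρ (f x) i) (g z) z +
      ∑ j : Fin k with Odd j.val, min (a z (predSymbol j)) (a z j) ≤ ∑ i, a z i := by
    intro z
    refine le_trans ?_ (add_sum_min_le (ha z) predSymbol
      (fun j hj => Nat.Odd.sub_odd hj odd_one) (f (g z)))
    gcongr
    exact mul_le_mul_of_nonneg_right (le_pStar P f _) (prod_nonneg fun _ _ => vnn _ _)
  have hsum := sum_le_sum fun z (_ : z ∈ univ) => hz z
  rw [sum_add_distrib, sum_comm (f := fun z i => a z i), sum_comm] at hsum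
  simp only [hrow] at hsum
  have hlow : 1 / ((n : ℝ) + 1) * exp2neg (n * expo n ρ) *
        ∑ j : Fin k with Odd j.val, min (pStar P f (predSymbol j)) (pStar P f j) ≤
      ∑ j : Fin k with Odd j.val, ∑ z, min (a z (predSymbol j)) (a z j) := by
    rw [mul_sum]
    refine sum_le_sum fun j hj => ?_
    refine le_trans ?_ (le_sum_min_prod_V₁ hρ0.le hρ1 (pStar_nonneg hP_pos f _)
      (pStar_nonneg hP_pos f j) (mem_filter.1 hj).2)
    exact mul_le_mul_of_nonneg_right (exp2neg_expo_le_choose hn (by linarith) hρ1)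
      (le_min (pStar_nonneg hP_pos f _) (pStar_nonneg hP_pos f _))
  linarith

theorem addNoisePrivacy_le_rhoPrivacyN [Fintype 𝒳] [Nonempty 𝒳] (P : 𝒳 → ℝ) (f : 𝒳 → Fin k)
    (hk : 2 ≤ k) (n : ℕ) {ρ : ℝ} (h0 : 0 ≤ ρ) (h1 : ρ ≤ 1) :
    addNoisePrivacy P f n (V₁ k ρ) ≤ rhoPrivacyN P f n ρ :=
  (isGreatest_rhoPrivacyN P f n h1).2 ⟨_, fun _ => isQR_V₁ hk f h0 h1, rfl⟩

theorem rhoPrivacyN_le [Fintype 𝒳] [Nonempty 𝒳] {P : 𝒳 → ℝ} (hP_pos : ∀ x, 0 < P x)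
    (hP_sum : ∑ x, P x = 1) {f : 𝒳 → Fin k} (hf : Function.Surjective f) (hk : 0 < k) {ρ : ℝ}
    (hρ0 : 1 / 2 < ρ) (hρ1 : ρ ≤ 1) (hn : 1 ≤ n) :
    rhoPrivacyN P f n ρ ≤
      1 - ∑ i, pStar P f i + exp2neg (n * expo n ρ) * ∑ i, pStar P f i := by
  obtain ⟨W, hW, h⟩ := (isGreatest_rhoPrivacyN P f n hρ1).1
  rw [h]
  exact privacy_prodChannel_le hP_pos hP_sum hf hk hρ0 hρ1 hn hW

/-! ### Perfect recoverability -/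

/-- Recoverability 1 forces the response to equal f(X), so the best guess on output i is a most
likely point of that fibre. -/
theorem privacy_eq_of_isQR_one [Fintype 𝒳] [Nonempty 𝒳] {P : 𝒳 → ℝ} (hP_pos : ∀ x, 0 < P x)
    (hP_sum : ∑ x, P x = 1) {f : 𝒳 → Fin k} (hf : Function.Surjective f)
    {W : 𝒳 → Fin k → ℝ} (hW : IsQR f 1 W) : privacy P W = 1 - ∑ i, pStar P f i := by
  refine le_antisymm ?_ (le_ciInf fun g => ?_)
  · choose xs hxf hxP using exists_eq_pStar P hf
    refine (privacy_le_errorProb P W xs).trans ?_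
    rw [errorProb_eq P hW.1, hP_sum]
    refine sub_le_sub_left (sum_le_sum fun i _ => ?_) _
    have h := hW.2 (xs i)
    rw [hxf] at h
    rw [← hxP]
    exact le_mul_of_one_le_right (hP_pos _).le h
  · rw [errorProb_eq P hW.1, hP_sum]
    refine sub_le_sub_left (sum_le_sum fun i _ => ?_) _
    have hle : W (g i) i ≤ 1 := by
      rw [← hW.1.2 (g i)]
      exact single_le_sum (f := W (g i)) (fun j _ => hW.1.1 _ j) (mem_univ i)
    by_cases h : f (g i) = i
    · have := le_pStar P f (g i)
      rw [h] at this
      exact (mul_le_of_le_one_right (hP_pos _).le hle).trans this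
    · have h2 := sum_le_univ_sum_of_nonneg (s := {f (g i), i}) (hW.1.1 (g i))
      rw [hW.1.2, sum_pair h] at h2
      have h3 : W (g i) i = 0 := le_antisymm (by linarith [hW.2 (g i)]) (hW.1.1 _ _)
      rw [h3, mul_zero]
      exact pStar_nonneg hP_pos f i

theorem rhoPrivacy_one [Fintype 𝒳] [Nonempty 𝒳] {P : 𝒳 → ℝ} (hP_pos : ∀ x, 0 < P x)
    (hP_sum : ∑ x, P x = 1) {f : 𝒳 → Fin k} (hf : Function.Surjective f) (hk : 2 ≤ k) :
    rhoPrivacy P f 1 = 1 - ∑ i, pStar P f i := by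
  have h : {a | ∃ W : 𝒳 → Fin k → ℝ, IsQR f 1 W ∧ a = privacy P W} =
      {1 - ∑ i, pStar P f i} := by
    ext a
    refine ⟨?_, ?_⟩
    · rintro ⟨W, hW, rfl⟩
      exact privacy_eq_of_isQR_one hP_pos hP_sum hf hW
    · rintro rfl
      have hW := isQR_V₁ hk f zero_le_one le_rfl
      exact ⟨_, hW, (privacy_eq_of_isQR_one hP_pos hP_sum hf hW).symm⟩
  rw [rhoPrivacy, h, csSup_singleton]

end QueryPrivacy

end

open QueryPrivacy in
theorem proposition8 {𝒳 : Type*} [Fintype 𝒳] (P : 𝒳 → ℝ) (hP_pos : ∀ x, 0 < P x)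
    (hP_sum : ∑ x, P x = 1) (k : ℕ) (hk : 2 ≤ k) (f : 𝒳 → Fin k)
    (hf : Function.Surjective f) (ρ : ℝ) (hρ : 1 / 2 < ρ) (hρ' : ρ ≤ 1) :
    -- upper bound
    (∀ n : ℕ, 1 ≤ n →
      (((n / 2 : ℕ) : ℝ) + 1) * exp2neg (n * expo n ρ) ≤ 1 - min ρ (rhoC P f) →
      rhoPrivacyN P f n ρ ≤ 1 - ∑ i, pStar P f i
        + (((n / 2 : ℕ) : ℝ) + 1) * exp2neg (n * expo n ρ) * ∑ i, pStar P f i) ∧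
    -- lower bound
    (Antitone (pStar P f) → ∀ n : ℕ, 1 ≤ n →
      addNoisePrivacy P f n (V₁ k ρ) ≤ rhoPrivacyN P f n ρ ∧
      1 - ∑ i, pStar P f i + 1 / ((n : ℝ) + 1) * exp2neg (n * expo n ρ)
          * ∑ i ∈ Finset.univ.filter (fun i : Fin k => Odd i.val), pStar P f i ≤ addNoisePrivacy P f n (V₁ k ρ)) ∧
    -- limit and exponential rate
    rhoPrivacy P f 1 = 1 - ∑ i, pStar P f i ∧
    Filter.Tendsto (fun n : ℕ => rhoPrivacyN P f n ρ) Filter.atTop (𝓝 (rhoPrivacy P f 1)) ∧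
    Filter.Tendsto (fun n : ℕ => expo n ρ) Filter.atTop (𝓝 (berDiv (1 / 2) ρ)) ∧
    0 < berDiv (1 / 2) ρ ∧
    HasExpRate (fun n => rhoPrivacyN P f n ρ - rhoPrivacy P f 1) (berDiv (1 / 2) ρ) ∧
    (Antitone (pStar P f) →
      HasExpRate (fun n => addNoisePrivacy P f n (V₁ k ρ) - rhoPrivacy P f 1)
        (berDiv (1 / 2) ρ)) := by
  classical
  have hk0 : 0 < k := by omega
  have : Nonempty 𝒳 := ⟨(hf ⟨0, hk0⟩).choose⟩
  have hρ0 : 0 < ρ := by linarith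
  have hpos : ∀ i, 0 < pStar P f i := fun i => by
    obtain ⟨x, -, hx⟩ := exists_eq_pStar P hf i
    exact hx ▸ hP_pos x
  have hS : 0 ≤ ∑ i, pStar P f i := Finset.sum_nonneg fun i _ => (hpos i).le
  have hone := rhoPrivacy_one hP_pos hP_sum hf hk
  have hup : ∀ n : ℕ, 1 ≤ n → _ := fun n hn =>
    rhoPrivacyN_le (n := n) hP_pos hP_sum hf hk0 hρ hρ' hn
  have hmid := fun n : ℕ => addNoisePrivacy_le_rhoPrivacyN P f hk n hρ0.le hρ'
  have hlow : ∀ n : ℕ, 1 ≤ n → _ := fun n hn =>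
    le_addNoisePrivacy (n := n) hP_pos hP_sum f hk hρ hρ' hn
  set S := ∑ i, pStar P f i with hSdef
  -- Symbol 1 exists as k ≥ 2, so the pair sum is positive whatever the order of the fibre maxima.
  -- It serves as the lower constant in the rate.
  have hcpos : 0 < ∑ j : Fin k with Odd j.val,
      min (pStar P f (predSymbol j)) (pStar P f j) :=
    Finset.sum_pos (fun j _ => lt_min (hpos _) (hpos _))
      ⟨⟨1, by omega⟩, Finset.mem_filter.2 ⟨Finset.mem_univ _, odd_one⟩⟩
  have hE : ∀ n : ℕ, 0 ≤ exp2neg (n * expo n ρ) := fun n => exp2neg_nonneg _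
  refine ⟨fun n hn _ => (hup n hn).trans ?_, fun hanti n hn => ⟨hmid n, ?_⟩, hone, ?_,
    tendsto_expo hρ0 hρ', berDiv_pos (by norm_num) (by norm_num) hρ0.le hρ' hρ.ne, ?_,
    fun _ => ?_⟩
  · gcongr
    exact le_mul_of_one_le_left (hE n) (by linarith [Nat.cast_nonneg (α := ℝ) (n / 2)])
  · refine le_trans ?_ (hlow n hn)
    -- The ordering makes j the lighter symbol of each pair, which yields the stated constant.
    have : ∀ j : Fin k, min (pStar P f (predSymbol j)) (pStar P f j) = pStar P f j := fun j =>
      min_eq_right (hanti (Nat.sub_le _ _ : (j : ℕ) - 1 ≤ j))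
    simp only [this, le_refl]
  · rw [hone]
    refine tendsto_of_tendsto_of_tendsto_of_le_of_le' (g := fun _ => 1 - S)
      (h := fun n : ℕ => 1 - S + exp2neg (n * expo n ρ) * S) tendsto_const_nhds ?_ ?_ ?_
    · simpa using ((tendsto_exp2neg_expo hρ hρ').mul_const S).const_add (1 - S)
    · filter_upwards [Filter.eventually_ge_atTop 1] with n hn
      refine le_trans (le_add_of_nonneg_right ?_) ((hlow n hn).trans (hmid n))
      have := hE n
      positivity
    · filter_upwards [Filter.eventually_ge_atTop 1] with n hn using hup n hn
  · refine hasExpRate_of_bounds hρ0 hρ' hcpos (C := S) (fun n hn => ?_) fun n hn => ?_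
    · linarith [hlow n hn, hmid n]
    · linarith [hup n hn]
  · refine hasExpRate_of_bounds hρ0 hρ' hcpos (C := S) (fun n hn => ?_) fun n hn => ?_
    · linarith [hlow n hn]
    · linarith [hup n hn, hmid n]
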